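/- Let $N\ge 0$. Consider an $N$-qubit device controlled by $M$ binary switches, i.e. a map $c\mapsto H(c)$ assigning to each switch configuration $c\in\{0,1\}^M$ a Hermitian $2^N\times 2^N$ matrix (the Hamiltonian of the device in that configuration). Let $m\ge 1$, and let $H_1=H(c_1),\dots,H_m=H(c_m)$ be finitely many Hamiltonians provided by switch configurations $c_1,\dots,c_m$ which are complete: the real Lie algebra generated by $-iH_1,\dots,-iH_m$ (under the commutator) is $\mathfrak{su}(2^N)$, the traceless skew-Hermitian matrices. Then every quantum gate $U\in SU(2^N)$ is exactly a finite product of time evolutions that runs cyclically through $H_1,\dots,H_m$: there are a number of steps $n\in\mathbb{N}$ (which may depend on $U$) and times $t_1,\dots,t_n\ge 0$ such that $$U=e^{-it_nH_{j_n}}\cdots e^{-it_2H_{j_2}}\,e^{-it_1H_{j_1}},\qquad j_k\in\{1,\dots,m\},\quad j_k\equiv k \pmod m .$$ Moreover, such families exist: for every $N\ge 1$ there is an $N$-qubit device with $N+1$ binary switches, and $N+2$ switch configurations, whose $N+2$ Hamiltonians are pairwise distinct and complete. -/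

import Mathlib

attribute [local instance] LieRing.ofAssociativeRing

/-- Operators on the state space of `N` qubits, as complex `2 ^ N × 2 ^ N` matrices. -/
abbrev QubitOp (N : ℕ) : Type := Matrix (Fin (2 ^ N)) (Fin (2 ^ N)) ℂ

/-- The real Lie algebra `su(2 ^ N)` of traceless skew-Hermitian matrices, with the commutator
as Lie bracket. -/
def suAlgebra (N : ℕ) : LieSubalgebra ℝ (QubitOp N) where
  carrier := {X | X.conjTranspose = -X ∧ X.trace = 0}
  zero_mem' := by simp
  add_mem' := by
    rintro X Y ⟨hX, hX'⟩ ⟨hY, hY'⟩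
    exact ⟨by rw [Matrix.conjTranspose_add, hX, hY, neg_add], by
      rw [Matrix.trace_add, hX', hY', add_zero]⟩
  smul_mem' := by
    rintro c X ⟨hX, hX'⟩
    exact ⟨by rw [Matrix.conjTranspose_smul, hX, star_trivial, smul_neg], by
      rw [Matrix.trace_smul, hX', smul_zero]⟩
  lie_mem' := by
    rintro X Y ⟨hX, hX'⟩ ⟨hY, hY'⟩
    refine ⟨?_, ?_⟩
    · rw [Ring.lie_def, Matrix.conjTranspose_sub, Matrix.conjTranspose_mul,
        Matrix.conjTranspose_mul, hX, hY]
      simp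
    · rw [Ring.lie_def, Matrix.trace_sub, Matrix.trace_mul_comm, sub_self]

/-- An `N`-qubit device controlled by `M` binary switches: every configuration of the switches
determines the Hamiltonian according to which the device evolves. -/
structure SwitchedDevice (N M : ℕ) where
  /-- The Hamiltonian of the device for a given configuration of the switches. -/
  hamiltonian : (Fin M → Bool) → QubitOp N
  isHermitian : ∀ c, (hamiltonian c).IsHermitian

/-- A finite family of Hamiltonians is complete if the real Lie algebra generated by the
operators `-i H j` is the whole of `su(2 ^ N)`. -/
def IsCompleteFamily {N m : ℕ} (H : Fin m → QubitOp N) : Prop :=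
  LieSubalgebra.lieSpan ℝ (QubitOp N) (Set.range fun j => (-Complex.I) • H j) = suAlgebra N

/-- The time evolution `exp (-i t H)`. -/
noncomputable def timeEvolution {N : ℕ} (H : QubitOp N) (t : ℝ) : QubitOp N :=
  NormedSpace.exp ((-Complex.I * (t : ℂ)) • H)

/-- The operator realized by `n` steps that run cyclically through `H 0, …, H (m - 1)`, step `k`
(`k = 0, …, n - 1`) having duration `t k` and Hamiltonian `H (k mod m)`; later steps stand
on the left. -/
noncomputable def cyclicEvolution {N m : ℕ} [NeZero m] (H : Fin m → QubitOp N) (t : ℕ → ℝ) :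
    ℕ → QubitOp N
  | 0 => 1
  | n + 1 => timeEvolution (H (Fin.ofNat m n)) (t n) * cyclicEvolution H t n

/-!
**Controllability.** Let `S` be the semigroup generated by the evolutions `exp (-i t H j)`,
`t ≥ 0`. Since steps of duration zero may be inserted, `S` is exactly the set of cyclic evolutions
(`exists_cyclicEvolution_of_mem_closure`), so it has to be shown that `S` is all of `SU(2 ^ N)`.

A subspace `W` is a *reachable tangent* at `g ∈ S` if `W * g` consists of velocities at `g` of a
differentiable family `F : E → S`. Multiplying families gives `W ⊔ g V g⁻¹` at `g * h` from
`W` at `g` and `V` at `h`. If `W` has maximal dimension, none of these products can enlarge it,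
which makes `W` contain each generator `A` and be stable under `ad A`; hence `W` contains the whole
Lie algebra generated by the `A`s (`exists_isReachableTangent_lieSpan`). With `W = su(2 ^ N)` and a
linear complement `C` of it, the map `(P, y) ↦ exp P * F y` on `C × E` maps neighbourhoods of `(0, x)`,
where `F x = g`, onto neighbourhoods of `g`, and `exp P` is in `SU(2 ^ N)` for small `P ∈ C` only if
`P = 0`: so `S` is a neighbourhood of `g` in `SU(2 ^ N)`. In a compact group the powers of `g` come
back to `g⁻¹`, so `S` is also a neighbourhood of `1`
(`Submonoid.mem_nhds_one_of_mem_nhds`). Finally every `U ∈ SU(2 ^ N)` is `exp X` with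
`X ∈ su(2 ^ N)`, thus a power of `exp (X / k)`, which is in `S` for `k` large.

**Existence of complete families.** The witness is a chain of `2 ^ N` levels with a
nearest-neighbour hopping that is always on, in which switch `i` detunes level `i`, for `i ≤ N`; the
configurations are those with at most one switch on. Modulo scalars, the detuning of the first
level isolates the hopping between the first two levels, the two together produce the detuning of
the second level, and so on along the chain (`skewHermitian_mem_of_chainHopping_mem`).
-/

open Filter Topology NormedSpace Matrix

/-! ### Accessibility in a finite-dimensional algebra -/

/-- The adjoint action `X ↦ g X g⁻¹` of a unit `g` of an algebra, as a linear equivalence. -/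
def unitConj {𝔸 : Type*} [Ring 𝔸] [Algebra ℝ 𝔸] (g : 𝔸ˣ) : 𝔸 ≃ₗ[ℝ] 𝔸 where
  toFun X := g * X * ↑g⁻¹
  invFun X := ↑g⁻¹ * X * g
  map_add' X Y := by simp [mul_add, add_mul]
  map_smul' c X := by simp
  left_inv X := by simp [mul_assoc]
  right_inv X := by simp [mul_assoc]

theorem unitConj_apply {𝔸 : Type*} [Ring 𝔸] [Algebra ℝ 𝔸] (g : 𝔸ˣ) (X : 𝔸) :
    unitConj g X = g * X * ↑g⁻¹ := rfl

section Accessibility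

variable {𝔸 : Type*} [NormedRing 𝔸] [NormedAlgebra ℝ 𝔸]

/-- `W` is a space of tangent directions reachable at `g` inside the submonoid `S`: there is a map
`F`, strictly differentiable at `x` and with values in `S` near `x`, such that `F x = g` and the
range of its derivative contains `W * g`. Directions are translated to `1` from the right; the
parameter space `E` is an arbitrary Banach space, so that families can be multiplied by taking
products of parameter spaces. -/
def IsReachableTangent (S : Submonoid 𝔸) (g : 𝔸) (W : Submodule ℝ 𝔸) : Prop :=
  ∃ (E : Type) (_ : NormedAddCommGroup E) (_ : NormedSpace ℝ E) (_ : CompleteSpace E)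
    (F : E → 𝔸) (F' : E →L[ℝ] 𝔸) (x : E), HasStrictFDerivAt F F' x ∧ F x = g ∧
      (∀ᶠ y in 𝓝 x, F y ∈ S) ∧ ∀ w ∈ W, ∃ v, F' v = w * g

theorem IsReachableTangent.mem {S : Submonoid 𝔸} {g : 𝔸} {W : Submodule ℝ 𝔸}
    (h : IsReachableTangent S g W) : g ∈ S := by
  obtain ⟨E, _, _, _, F, F', x, -, rfl, hS, -⟩ := h
  exact hS.self_of_nhds

theorem IsReachableTangent.mono {S : Submonoid 𝔸} {g : 𝔸} {V W : Submodule ℝ 𝔸}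
    (h : IsReachableTangent S g W) (hVW : V ≤ W) : IsReachableTangent S g V := by
  obtain ⟨E, _, _, _, F, F', x, hF, hFx, hFS, hFW⟩ := h
  exact ⟨E, _, _, ‹_›, F, F', x, hF, hFx, hFS, fun w hw => hFW w (hVW hw)⟩

theorem isReachableTangent_one_bot (S : Submonoid 𝔸) : IsReachableTangent S 1 ⊥ :=
  ⟨PUnit, inferInstance, inferInstance, inferInstance, fun _ => 1, 0, PUnit.unit,
    hasStrictFDerivAt_const _ _, rfl, Eventually.of_forall fun _ => S.one_mem,
    fun w hw => ⟨0, by simp [(Submodule.mem_bot ℝ).1 hw]⟩⟩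

theorem IsReachableTangent.mul {S : Submonoid 𝔸} {g h : 𝔸ˣ} {W V : Submodule ℝ 𝔸}
    (hg : IsReachableTangent S g W) (hh : IsReachableTangent S h V) :
    IsReachableTangent S ↑(g * h) (W ⊔ V.map (unitConj g).toLinearMap) := by
  obtain ⟨E, _, _, _, F, F', x, hF, hFx, hFS, hFW⟩ := hg
  obtain ⟨E₂, _, _, _, G, G', y, hG, hGy, hGS, hGV⟩ := hh
  refine ⟨E × E₂, inferInstance, inferInstance, inferInstance, fun p => F p.1 * G p.2, _, (x, y),
    (hF.comp (x, y) hasStrictFDerivAt_fst).mul' (hG.comp (x, y) hasStrictFDerivAt_snd), ?_, ?_, ?_⟩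
  · simp [hFx, hGy]
  · filter_upwards [(continuous_fst.tendsto (x, y)).eventually hFS,
      (continuous_snd.tendsto (x, y)).eventually hGS] with p h₁ h₂ using S.mul_mem h₁ h₂
  · intro w hw
    obtain ⟨w₁, h₁, w₂, h₂, rfl⟩ := Submodule.mem_sup.1 hw
    obtain ⟨w₃, h₃, rfl⟩ := h₂
    obtain ⟨v₁, e₁⟩ := hFW w₁ h₁
    obtain ⟨v₃, e₃⟩ := hGV w₃ h₃
    refine ⟨(v₁, v₃), ?_⟩
    simp [hFx, hGy, e₁, e₃, unitConj_apply, add_mul, mul_assoc, add_comm]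

variable [CompleteSpace 𝔸]

/-- The one-parameter group generated by `A`, as a family of units. -/
noncomputable def expUnit (A : 𝔸) (t : ℝ) : 𝔸ˣ where
  val := exp (t • A)
  inv := exp (-(t • A))
  val_inv := by
    let _ := NormedAlgebra.restrictScalars ℚ ℝ 𝔸
    rw [← NormedSpace.exp_add_of_commute (Commute.neg_right (Commute.refl _))]; simp
  inv_val := by
    let _ := NormedAlgebra.restrictScalars ℚ ℝ 𝔸
    rw [← NormedSpace.exp_add_of_commute (Commute.neg_left (Commute.refl _))]; simp

theorem isReachableTangent_exp {S : Submonoid 𝔸} {A : 𝔸} (hS : ∀ t : ℝ, 0 ≤ t → exp (t • A) ∈ S)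
    {t : ℝ} (ht : 0 < t) : IsReachableTangent S (expUnit A t) (ℝ ∙ A) := by
  refine ⟨ℝ, inferInstance, inferInstance, inferInstance, fun s => exp (s • A), _, t,
    (hasStrictDerivAt_exp_smul_const' (𝕂 := ℝ) A t).hasStrictFDerivAt, rfl, ?_, ?_⟩
  · filter_upwards [lt_mem_nhds ht] with s hs using hS s hs.le
  · intro w hw
    obtain ⟨c, rfl⟩ := Submodule.mem_span_singleton.1 hw
    exact ⟨c, by simp [expUnit]⟩

theorem hasDerivAt_unitConj_expUnit (A X : 𝔸) (t : ℝ) :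
    HasDerivAt (fun s => unitConj (expUnit A s) X) (unitConj (expUnit A t) (A * X - X * A)) t := by
  have h₁ := hasDerivAt_exp_smul_const (𝕂 := ℝ) A t
  have h₂ := hasDerivAt_exp_smul_const' (𝕂 := ℝ) (-A) t
  convert! (h₁.mul_const X).mul h₂ using 1
  · ext s; simp [unitConj, expUnit]
  · simp only [unitConj, expUnit, LinearEquiv.coe_mk, LinearMap.coe_mk, AddHom.coe_mk,
      Units.inv_mk, smul_neg]
    noncomm_ring

/-- If `S` contains the forward half of the one-parameter groups generated by `s`, then at some
point of `S` all directions of the Lie algebra generated by `s` are reachable: a reachable space of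
maximal dimension contains `s` and is stable under `ad A` for all `A ∈ s`. -/
theorem exists_isReachableTangent_lieSpan [FiniteDimensional ℝ 𝔸] {S : Submonoid 𝔸} {s : Set 𝔸}
    (hS : ∀ A ∈ s, ∀ t : ℝ, 0 ≤ t → exp (t • A) ∈ S) :
    ∃ (g : 𝔸ˣ) (W : Submodule ℝ 𝔸), IsReachableTangent S g W ∧
      (LieSubalgebra.lieSpan ℝ 𝔸 s).toSubmodule ≤ W := by
  obtain ⟨⟨g, W⟩, hgW : IsReachableTangent S g W, hmax⟩ := WellFounded.has_min
    (measure fun p : 𝔸ˣ × Submodule ℝ 𝔸 => Module.finrank ℝ 𝔸 - Module.finrank ℝ p.2).wf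
    {p | IsReachableTangent S p.1 p.2} ⟨(1, ⊥), isReachableTangent_one_bot S⟩
  have hmax' : ∀ (h : 𝔸ˣ) (V : Submodule ℝ 𝔸), IsReachableTangent S h V →
      Module.finrank ℝ V ≤ Module.finrank ℝ W := by
    intro h V hV
    have h₁ : ¬ (Module.finrank ℝ 𝔸 - Module.finrank ℝ V <
      Module.finrank ℝ 𝔸 - Module.finrank ℝ W) := hmax (h, V) hV
    have h₂ := Submodule.finrank_le V
    have h₃ := Submodule.finrank_le W
    omega
  have hfr : ∀ (h : 𝔸ˣ) (V : Submodule ℝ 𝔸),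
      Module.finrank ℝ (V.map (unitConj h).toLinearMap) = Module.finrank ℝ V :=
    fun h V => LinearEquiv.finrank_map_eq (unitConj h) V
  -- By maximality of `W`, the space `V ⊔ h W h⁻¹` at `h * g` is no larger than `h W h⁻¹`.
  have hleft : ∀ (h : 𝔸ˣ) (V : Submodule ℝ 𝔸), IsReachableTangent S h V →
      V ≤ W.map (unitConj h).toLinearMap := by
    intro h V hV
    have h₁ := hmax' _ _ (hV.mul hgW)
    rw [← hfr h W] at h₁
    rw [Submodule.eq_of_le_of_finrank_le le_sup_right h₁]
    exact le_sup_left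
  -- Likewise `W ⊔ g V g⁻¹`, reachable at `g * h`, is no larger than `W`.
  have hright : ∀ (h : 𝔸ˣ) (V : Submodule ℝ 𝔸), IsReachableTangent S h V →
      V.map (unitConj g).toLinearMap ≤ W := by
    intro h V hV
    have h₁ := hmax' _ _ (hgW.mul hV)
    rw [Submodule.eq_of_le_of_finrank_le (le_sup_left (a := W)) h₁]
    exact le_sup_right
  -- `A ∈ exp A * W * exp (-A)`, and `A` commutes with `exp A`.
  have hmem : ∀ A ∈ s, A ∈ W := by
    intro A hA
    obtain ⟨X, hX, hXA⟩ := hleft _ _ (isReachableTangent_exp (hS A hA) one_pos)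
      (Submodule.mem_span_singleton_self A)
    have hX' : X = A := by
      apply (unitConj (expUnit A 1)).injective
      refine hXA.trans ?_
      let _ := NormedAlgebra.restrictScalars ℚ ℝ 𝔸
      rw [unitConj_apply]
      have : Commute (↑(expUnit A 1) : 𝔸) A :=
        ((Commute.refl A).smul_left (1 : ℝ)).exp_left
      rw [this.eq, mul_assoc, Units.mul_inv, mul_one]
    exact hX' ▸ hX
  have hconj : ∀ A ∈ s, ∀ t : ℝ, 0 < t → ∀ X ∈ W,
      unitConj g (unitConj (expUnit A t) X) ∈ W := by
    intro A hA t ht X hX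
    refine hright _ _ ((isReachableTangent_exp (hS A hA) ht).mul hgW) ⟨_, ?_, rfl⟩
    exact Submodule.mem_sup_right ⟨X, hX, rfl⟩
  -- The curve `t ↦ g exp (t A) X exp (-t A) g⁻¹` stays in `W`, hence so does its velocity at
  -- `t = 1`, which is the conjugate of `⁅A, X⁆` by `g exp A`; this conjugation maps `W` onto `W`.
  have hbr : ∀ A ∈ s, ∀ X ∈ W, ⁅A, X⁆ ∈ W := by
    intro A hA X hX
    set f : 𝔸 →ₗ[ℝ] 𝔸 := (unitConj g).toLinearMap with hf
    have h₁ : HasDerivAt (fun t => unitConj g (unitConj (expUnit A t) X))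
        (unitConj g (unitConj (expUnit A 1) (A * X - X * A))) 1 :=
      (LinearMap.toContinuousLinearMap f).hasFDerivAt.comp_hasDerivAt 1
        (hasDerivAt_unitConj_expUnit A X 1)
    have h₂ : unitConj g (unitConj (expUnit A 1) ⁅A, X⁆) ∈ W := by
      refine (Submodule.closed_of_finiteDimensional W).mem_of_tendsto
        (hasDerivAt_iff_tendsto_slope.1 h₁) ?_
      filter_upwards [mem_nhdsWithin_of_mem_nhds (lt_mem_nhds (zero_lt_one' ℝ))] with t ht
      exact W.smul_mem _ (W.sub_mem (hconj A hA t ht X hX) (hconj A hA 1 one_pos X hX))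
    have h₃ : W.map (((unitConj (expUnit A 1)).trans (unitConj g)).toLinearMap) = W := by
      refine Submodule.eq_of_le_of_finrank_le ?_ ?_
      · rintro _ ⟨Y, hY, rfl⟩
        exact hconj A hA 1 one_pos Y hY
      · exact (LinearEquiv.finrank_map_eq ((unitConj (expUnit A 1)).trans (unitConj g)) W).ge
    rw [← h₃] at h₂
    obtain ⟨Y, hY, hYX⟩ := h₂
    have : Y = ⁅A, X⁆ := ((unitConj (expUnit A 1)).trans (unitConj g)).injective hYX
    exact this ▸ hY
  refine ⟨g, W, hgW, ?_⟩
  -- The elements of `W` whose adjoint action preserves `W` form a Lie subalgebra.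
  let N : LieSubalgebra ℝ 𝔸 :=
    { carrier := {Y | Y ∈ W ∧ ∀ X ∈ W, ⁅Y, X⁆ ∈ W}
      zero_mem' := ⟨W.zero_mem, fun X _ => by simp⟩
      add_mem' := fun ha hb => ⟨W.add_mem ha.1 hb.1, fun X hX => by
        rw [add_lie]; exact W.add_mem (ha.2 X hX) (hb.2 X hX)⟩
      smul_mem' := fun c Y hY => ⟨W.smul_mem c hY.1, fun X hX => by
        rw [smul_lie]; exact W.smul_mem c (hY.2 X hX)⟩
      lie_mem' := fun {Y Z} hY hZ => ⟨hY.2 Z hZ.1, fun X hX => by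
        rw [lie_lie]; exact W.sub_mem (hY.2 _ (hZ.2 X hX)) (hZ.2 _ (hY.2 X hX))⟩ }
  have hN : LieSubalgebra.lieSpan ℝ 𝔸 s ≤ N :=
    LieSubalgebra.lieSpan_le.2 fun A hA => ⟨hmem A hA, hbr A hA⟩
  exact fun Y hY => (hN hY).1

/-- If `C` complements a reachable tangent space, then `(P, y) ↦ exp P * F y` has surjective
derivative on `C × E`, so every element near `g` is in `exp P * S` for some small `P ∈ C`. -/
theorem IsReachableTangent.eventually_eq_exp_mul [FiniteDimensional ℝ 𝔸] {S : Submonoid 𝔸} {g : 𝔸ˣ}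
    {W C : Submodule ℝ 𝔸} (h : IsReachableTangent S g W) (hC : W ⊔ C = ⊤) {N : Set 𝔸}
    (hN : N ∈ 𝓝 0) : ∀ᶠ V in 𝓝 (g : 𝔸), ∃ P ∈ C, P ∈ N ∧ ∃ s ∈ S, V = exp P * s := by
  obtain ⟨E, _, _, _, F, F', x, hF, hFx, hFS, hFW⟩ := h
  have : CompleteSpace C := FiniteDimensional.complete ℝ C
  have hexp : HasStrictFDerivAt (exp : 𝔸 → 𝔸) (1 : 𝔸 →L[ℝ] 𝔸) (C.subtypeL ((0 : C), x).1) := by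
    simpa using hasStrictFDerivAt_exp_zero (𝕂 := ℝ) (𝔸 := 𝔸)
  have hΦ := ((hexp.comp ((0 : C), x) (C.subtypeL.hasStrictFDerivAt.comp ((0 : C), x)
    hasStrictFDerivAt_fst))).mul' (hF.comp ((0 : C), x) hasStrictFDerivAt_snd)
  have hmap := hΦ.map_nhds_eq_of_surj (by
    rw [eq_top_iff]
    rintro V -
    obtain ⟨w, hw, c, hc, hwc⟩ := Submodule.mem_sup.1 (hC ▸ Submodule.mem_top :
      V * ↑g⁻¹ ∈ W ⊔ C)
    obtain ⟨v, hv⟩ := hFW w hw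
    refine ⟨(⟨c, hc⟩, v), ?_⟩
    have : V = (w + c) * g := by rw [hwc, mul_assoc, Units.inv_mul, mul_one]
    simp [hFx, hv, this, add_mul])
  have hg : exp ((0 : C) : 𝔸) * F x = g := by simp [hFx]
  simp only [Pi.mul_apply, Submodule.subtypeL_apply, hg] at hmap
  rw [← hmap, eventually_map]
  have hN' : ∀ᶠ p : C × E in 𝓝 ((0 : C), x), (p.1 : 𝔸) ∈ N :=
    (continuous_subtype_val.comp continuous_fst).continuousAt.eventually_mem (by simpa using hN)
  filter_upwards [hN', (continuous_snd.tendsto ((0 : C), x)).eventually hFS] with p h₁ h₂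
  exact ⟨p.1, p.1.2, h₁, F p.2, h₂, rfl⟩

end Accessibility

/-! ### Recurrence in compact groups -/

/-- In a compact group the powers of `g` accumulate at `g⁻¹`, so the translate of a neighbourhood
of `g` by a suitable power of `g` is a neighbourhood of `1`. -/
theorem Submonoid.mem_nhds_one_of_mem_nhds {G : Type*} [Group G] [TopologicalSpace G]
    [IsTopologicalGroup G] [CompactSpace G] {S : Submonoid G} {g : G} (h : (S : Set G) ∈ 𝓝 g) :
    (S : Set G) ∈ 𝓝 1 := by
  have hg : g ∈ S := mem_of_mem_nhds h
  have h₁ : {x : G | x⁻¹ ∈ interior (S : Set G)} ∈ 𝓝 (g ^ (-1 : ℤ)) :=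
    (isOpen_interior.preimage continuous_inv).mem_nhds
      (by simpa using mem_interior_iff_mem_nhds.2 h)
  obtain ⟨n, hn⟩ := ((mapClusterPt_self_zpow_atTop_pow g (-1)).frequently h₁).exists
  have h₂ : (fun x : G => x * (g ^ n)⁻¹) ⁻¹' (S : Set G) ∈ 𝓝 1 :=
    (continuous_mul_const _).continuousAt.preimage_mem_nhds
      (by simpa using mem_interior_iff_mem_nhds.1 hn)
  filter_upwards [h₂] with x hx
  simpa using S.mul_mem hx (S.pow_mem hg n)

/-! ### The exponential map of the special unitary group -/

section
variable {n : Type*} [Fintype n] [DecidableEq n]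

theorem Matrix.exists_eq_conj_diagonal_of_skewHermitian {X : Matrix n n ℂ} (hX : Xᴴ = -X) :
    ∃ V ∈ unitaryGroup n ℂ, ∃ a : n → ℝ,
      X = V * diagonal (fun j => (a j : ℂ) * Complex.I) * V⁻¹ := by
  have hA : (-Complex.I • X).IsHermitian := by
    simp [Matrix.IsHermitian, hX]
  refine ⟨hA.eigenvectorUnitary, hA.eigenvectorUnitary.2, hA.eigenvalues, ?_⟩
  have h := hA.spectral_theorem
  rw [Unitary.conjStarAlgAut_apply] at h
  have h₂ : X = Complex.I • (-Complex.I • X) := by simp [smul_smul]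
  have h₃ : (hA.eigenvectorUnitary : Matrix n n ℂ)⁻¹ =
      star (hA.eigenvectorUnitary : Matrix n n ℂ) :=
    Matrix.inv_eq_left_inv (Unitary.coe_star_mul_self hA.eigenvectorUnitary)
  rw [h₃]
  conv_lhs => rw [h₂, h]
  rw [← smul_mul_assoc, ← mul_smul_comm, ← diagonal_smul]
  congr 3
  ext j
  simp [mul_comm]

theorem Matrix.exp_conj_diagonal {V : Matrix n n ℂ} (hV : V ∈ unitaryGroup n ℂ) (z : n → ℂ) :
    exp (V * diagonal z * V⁻¹) = V * diagonal (fun j => Complex.exp (z j)) * V⁻¹ := by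
  have hu : IsUnit V := ⟨(Unitary.toUnits ⟨V, hV⟩), rfl⟩
  rw [exp_conj V _ hu, exp_diagonal, Pi.exp_def, Complex.exp_eq_exp_ℂ]

theorem Matrix.det_exp_of_skewHermitian {X : Matrix n n ℂ} (hX : Xᴴ = -X) :
    (exp X).det = Complex.exp X.trace := by
  obtain ⟨V, hV, a, rfl⟩ := exists_eq_conj_diagonal_of_skewHermitian hX
  have hu : IsUnit V := ⟨(Unitary.toUnits ⟨V, hV⟩), rfl⟩
  rw [exp_conj_diagonal hV, det_conj hu, det_diagonal, trace_conj hu, trace_diagonal,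
    Complex.exp_sum]

theorem Matrix.exp_mem_unitaryGroup {X : Matrix n n ℂ} (hX : Xᴴ = -X) :
    exp X ∈ unitaryGroup n ℂ := by
  have hu := (isUnit_exp X)
  rw [mem_unitaryGroup_iff', star_eq_conjTranspose, ← exp_conjTranspose, hX, exp_neg,
    nonsing_inv_mul _ ((isUnit_iff_isUnit_det _).1 hu)]

open scoped Matrix.Norms.L2Operator in
/-- The logarithm is applied through the continuous functional calculus: the spectrum is finite, so
the cut of the principal branch does no harm. -/
theorem Matrix.exists_skewHermitian_exp_eq {U : Matrix n n ℂ} (hU : U ∈ unitaryGroup n ℂ) :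
    ∃ X : Matrix n n ℂ, Xᴴ = -X ∧ exp X = U := by
  have hcont : ∀ f : ℂ → ℂ, ContinuousOn f (spectrum ℂ U) := fun f =>
    (Matrix.finite_spectrum U).continuousOn f
  have hnorm : ∀ z ∈ spectrum ℂ U, ‖z‖ = 1 := fun z hz => spectrum.norm_eq_one_of_unitary hU hz
  have hstar : IsStarNormal U := ⟨by
    rw [commute_iff_eq, Unitary.star_mul_self_of_mem hU, Unitary.mul_star_self_of_mem hU]⟩
  refine ⟨cfc Complex.log U, ?_, ?_⟩
  · rw [← star_eq_conjTranspose, ← cfc_star, ← cfc_neg]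
    refine cfc_congr fun z hz => ?_
    apply Complex.ext <;> simp [Complex.log_re, hnorm z hz]
  · rw [← CFC.exp_eq_normedSpace_exp (𝕜 := ℂ), ← cfc_comp' _ _ _
      exp_continuous.continuousOn (hcont _)]
    conv_rhs => rw [← cfc_id' ℂ U]
    refine cfc_congr fun z hz => ?_
    have : z ≠ 0 := by
      rintro rfl
      simpa using hnorm 0 hz
    simpa [← Complex.exp_eq_exp_ℂ] using Complex.exp_log this

/-- The exponential maps `su(n)` onto `SU(n)`. The trace of a skew-Hermitian logarithm is a multiple
of `2πi`; subtracting it from one eigenvalue does not change the exponential. -/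
theorem Matrix.exists_skewHermitian_trace_eq_zero_exp_eq [Nonempty n] {U : Matrix n n ℂ}
    (hU : U ∈ specialUnitaryGroup n ℂ) :
    ∃ X : Matrix n n ℂ, Xᴴ = -X ∧ X.trace = 0 ∧ exp X = U := by
  rw [mem_specialUnitaryGroup_iff] at hU
  obtain ⟨X, hX, hXU⟩ := exists_skewHermitian_exp_eq hU.1
  have hdet := det_exp_of_skewHermitian hX
  rw [hXU, hU.2, eq_comm, Complex.exp_eq_one_iff] at hdet
  obtain ⟨k, hk⟩ := hdet
  obtain ⟨V, hV, a, rfl⟩ := exists_eq_conj_diagonal_of_skewHermitian hX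
  have hu : IsUnit V := ⟨(Unitary.toUnits ⟨V, hV⟩), rfl⟩
  rw [trace_conj hu, trace_diagonal] at hk
  have hV' : V⁻¹ = star V := Matrix.inv_eq_left_inv (Unitary.star_mul_self_of_mem hV)
  -- The eigenvalue at `j₀` absorbs the trace.
  let j₀ : n := Classical.arbitrary n
  let b : n → ℂ := fun j => (a j : ℂ) * Complex.I -
    if j = j₀ then k * (2 * Real.pi * Complex.I) else 0
  refine ⟨V * diagonal b * V⁻¹, ?_, ?_, ?_⟩
  · rw [hV', star_eq_conjTranspose, conjTranspose_mul, conjTranspose_mul,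
      conjTranspose_conjTranspose, diagonal_conjTranspose, ← mul_assoc, ← neg_mul, ← mul_neg,
      diagonal_neg]
    congr 3
    ext j
    by_cases h : j = j₀ <;> simp [b, h]; ring
  · rw [trace_conj hu, trace_diagonal]
    simp [b, hk]
  · rw [← hXU, exp_conj_diagonal hV, exp_conj_diagonal hV]
    congr 3
    ext j
    by_cases h : j = j₀
    · simp only [b, h, if_true]
      rw [Complex.exp_sub, Complex.exp_int_mul_two_pi_mul_I, div_one]
    · simp [b, h]

instance Matrix.specialUnitaryGroup.instCompactSpace : CompactSpace (specialUnitaryGroup n ℂ) := by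
  refine isCompact_iff_compactSpace.1 (IsCompact.of_isClosed_subset
    (isCompact_univ_pi fun _ => isCompact_univ_pi fun _ => isCompact_closedBall (0 : ℂ) 1) ?_ ?_)
  · have : (specialUnitaryGroup n ℂ : Set (Matrix n n ℂ)) =
        {U | star U * U = 1} ∩ {U | U.det = 1} := by
      ext U
      simp [mem_specialUnitaryGroup_iff, mem_unitaryGroup_iff']
    rw [this]
    exact (isClosed_eq (by fun_prop) continuous_const).inter
      (isClosed_eq (by fun_prop) continuous_const)
  · intro U hU i _ j _
    simpa using entry_norm_bound_of_unitary (mem_specialUnitaryGroup_iff.1 hU).1 i j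

instance Matrix.specialUnitaryGroup.instIsTopologicalGroup :
    IsTopologicalGroup (specialUnitaryGroup n ℂ) where
  continuous_inv := Continuous.subtype_mk (continuous_star.comp continuous_subtype_val) _

open scoped Matrix.Norms.Operator in
theorem Matrix.exists_nhds_zero_injOn_exp :
    ∃ N ∈ 𝓝 (0 : Matrix n n ℂ), Set.InjOn exp N := by
  have h : HasStrictFDerivAt (exp : Matrix n n ℂ → Matrix n n ℂ)
      ((ContinuousLinearEquiv.refl ℂ (Matrix n n ℂ)) : Matrix n n ℂ →L[ℂ] Matrix n n ℂ) 0 :=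
    hasStrictFDerivAt_exp_zero
  exact ⟨_, (h.toOpenPartialHomeomorph exp).open_source.mem_nhds
    h.mem_toOpenPartialHomeomorph_source, (h.toOpenPartialHomeomorph exp).injOn⟩

/-- Near `0` the exponential is injective, and both `exp Xᴴ = exp (-X)` and `exp (tr X) = 1` hold if
`exp X` is special unitary. -/
theorem Matrix.eventually_skewHermitian_of_exp_mem :
    ∀ᶠ X in 𝓝 (0 : Matrix n n ℂ), exp X ∈ specialUnitaryGroup n ℂ → Xᴴ = -X ∧ X.trace = 0 := by
  obtain ⟨N, hN, hinj⟩ := exists_nhds_zero_injOn_exp (n := n)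
  have h₁ : ∀ᶠ X in 𝓝 (0 : Matrix n n ℂ), Xᴴ ∈ N :=
    (continuous_id.matrix_conjTranspose).continuousAt.eventually_mem (by simpa using hN)
  have h₂ : ∀ᶠ X in 𝓝 (0 : Matrix n n ℂ), -X ∈ N :=
    continuous_neg.continuousAt.eventually_mem (by simpa using hN)
  have h₃ : ∀ᶠ X in 𝓝 (0 : Matrix n n ℂ), X.trace ∈ Metric.ball (0 : ℂ) 1 :=
    (continuous_id.matrix_trace).continuousAt.eventually_mem
      (by simpa using Metric.ball_mem_nhds (0 : ℂ) one_pos)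
  filter_upwards [h₁, h₂, h₃] with X h₁ h₂ h₃ hX
  rw [mem_specialUnitaryGroup_iff] at hX
  have hskew : Xᴴ = -X := by
    refine hinj h₁ h₂ ?_
    rw [exp_conjTranspose, exp_neg]
    exact (Matrix.inv_eq_left_inv (Unitary.star_mul_self_of_mem hX.1)).symm
  refine ⟨hskew, ?_⟩
  have hdet := det_exp_of_skewHermitian hskew
  rw [hX.2, eq_comm, Complex.exp_eq_one_iff] at hdet
  obtain ⟨k, hk⟩ := hdet
  rw [hk] at h₃ ⊢
  have hk0 : k = 0 := by
    by_contra hk0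
    have h1 : (1 : ℝ) ≤ |(k : ℝ)| := by exact_mod_cast Int.one_le_abs hk0
    have h4 : |(k : ℝ)| * (2 * Real.pi) < 1 := by
      simpa [abs_of_pos Real.pi_pos] using h₃
    nlinarith [Real.pi_gt_three]
  simp [hk0]

end

/-! ### Submonoids of the special unitary group -/

section
variable {N : ℕ}

theorem exp_mem_specialUnitaryGroup_of_mem_suAlgebra {X : QubitOp N} (hX : X ∈ suAlgebra N) :
    exp X ∈ specialUnitaryGroup (Fin (2 ^ N)) ℂ :=
  mem_specialUnitaryGroup_iff.2 ⟨exp_mem_unitaryGroup hX.1, by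
    rw [det_exp_of_skewHermitian hX.1, hX.2, Complex.exp_zero]⟩

open scoped Matrix.Norms.Operator in
/-- A submonoid of `SU(2 ^ N)` that contains the forward evolutions of a complete set of generators
is a neighbourhood in `SU(2 ^ N)` of one of its points. -/
theorem exists_eventually_mem_of_lieSpan_eq {S : Submonoid (QubitOp N)}
    {s : Set (QubitOp N)} (hs : LieSubalgebra.lieSpan ℝ (QubitOp N) s = suAlgebra N)
    (hexp : ∀ A ∈ s, ∀ t : ℝ, 0 ≤ t → exp (t • A) ∈ S)
    (hS : S ≤ specialUnitaryGroup (Fin (2 ^ N)) ℂ) :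
    ∃ g ∈ S, ∀ᶠ V in 𝓝 g, V ∈ specialUnitaryGroup (Fin (2 ^ N)) ℂ → V ∈ S := by
  obtain ⟨g, W, hgW, hW⟩ := exists_isReachableTangent_lieSpan hexp
  rw [hs] at hW
  obtain ⟨C, hC⟩ := Submodule.exists_isCompl (suAlgebra N).toSubmodule
  refine ⟨g, hgW.mem, ?_⟩
  filter_upwards [(hgW.mono hW).eventually_eq_exp_mul hC.sup_eq_top
    eventually_skewHermitian_of_exp_mem] with V hV hVSU
  obtain ⟨P, hPC, hP, v, hv, rfl⟩ := hV
  have hvSU := hS hv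
  have hexpP : exp P ∈ specialUnitaryGroup (Fin (2 ^ N)) ℂ := by
    have h := mul_mem hVSU (⟨v, hvSU⟩⁻¹ : specialUnitaryGroup (Fin (2 ^ N)) ℂ).2
    have h' : v * ((⟨v, hvSU⟩⁻¹ : specialUnitaryGroup (Fin (2 ^ N)) ℂ) : QubitOp N) = 1 :=
      congrArg Subtype.val (mul_inv_cancel (⟨v, hvSU⟩ : specialUnitaryGroup (Fin (2 ^ N)) ℂ))
    rwa [mul_assoc, h', mul_one] at h
  have hP0 : P = 0 := by
    have : P ∈ (suAlgebra N).toSubmodule ⊓ C := ⟨hP hexpP, hPC⟩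
    rwa [hC.inf_eq_bot, Submodule.mem_bot] at this
  rwa [hP0, exp_zero, one_mul]

/-- A submonoid of `SU(2 ^ N)` that contains the forward evolutions of a complete set of generators
is everything. -/
theorem specialUnitaryGroup_le_of_lieSpan_eq {S : Submonoid (QubitOp N)}
    {s : Set (QubitOp N)} (hs : LieSubalgebra.lieSpan ℝ (QubitOp N) s = suAlgebra N)
    (hexp : ∀ A ∈ s, ∀ t : ℝ, 0 ≤ t → exp (t • A) ∈ S)
    (hS : S ≤ specialUnitaryGroup (Fin (2 ^ N)) ℂ) :
    specialUnitaryGroup (Fin (2 ^ N)) ℂ ≤ S := by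
  obtain ⟨g, hg, hgS⟩ := exists_eventually_mem_of_lieSpan_eq hs hexp hS
  let T : Submonoid (specialUnitaryGroup (Fin (2 ^ N)) ℂ) := S.comap (Submonoid.subtype _)
  have hT : (T : Set (specialUnitaryGroup (Fin (2 ^ N)) ℂ)) ∈ 𝓝 ⟨g, hS hg⟩ := by
    filter_upwards [continuous_subtype_val.continuousAt.eventually hgS] with V hV using hV V.2
  intro U hU
  obtain ⟨X, hX, htr, rfl⟩ := exists_skewHermitian_trace_eq_zero_exp_eq hU
  have hX' : ∀ k : ℕ, ((k : ℝ)⁻¹ • X) ∈ suAlgebra N := fun k => (suAlgebra N).smul_mem _ ⟨hX, htr⟩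
  have hlim : Tendsto (fun k : ℕ => (⟨exp ((k : ℝ)⁻¹ • X),
      exp_mem_specialUnitaryGroup_of_mem_suAlgebra (hX' k)⟩ :
      specialUnitaryGroup (Fin (2 ^ N)) ℂ)) atTop (𝓝 1) := by
    rw [tendsto_subtype_rng]
    have hc : Continuous (fun r : ℝ => exp (r • X)) := by
      open scoped Matrix.Norms.Operator in
      let _ := NormedAlgebra.restrictScalars ℚ ℝ (QubitOp N)
      exact exp_continuous.comp (continuous_id.smul continuous_const)
    simpa [Function.comp_def] using (hc.tendsto 0).comp tendsto_inv_atTop_nhds_zero_nat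
  obtain ⟨k, hk, hk0⟩ := ((hlim.eventually_mem (Submonoid.mem_nhds_one_of_mem_nhds hT)).and
    (eventually_gt_atTop 0)).exists
  have hk1 : exp X = exp ((k : ℝ)⁻¹ • X) ^ k := by
    rw [← Matrix.exp_nsmul, ← Nat.cast_smul_eq_nsmul ℝ, smul_smul,
      mul_inv_cancel₀ (by exact_mod_cast hk0.ne'), one_smul]
  rw [hk1]
  exact S.pow_mem hk k

/-! ### Cyclic evolutions -/

theorem timeEvolution_eq (H : QubitOp N) (t : ℝ) :
    timeEvolution H t = exp (t • ((-Complex.I) • H)) := by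
  rw [timeEvolution, mul_comm, mul_smul, Complex.coe_smul]

theorem timeEvolution_zero (H : QubitOp N) : timeEvolution H 0 = 1 := by
  simp [timeEvolution]

variable {m : ℕ} [NeZero m]

theorem cyclicEvolution_congr (H : Fin m → QubitOp N) {t t' : ℕ → ℝ} {n : ℕ}
    (h : ∀ k < n, t k = t' k) : cyclicEvolution H t n = cyclicEvolution H t' n := by
  induction n with
  | zero => rfl
  | succ n ih =>
    rw [cyclicEvolution, cyclicEvolution, h n n.lt_succ_self,
      ih fun k hk => h k (hk.trans n.lt_succ_self)]

theorem cyclicEvolution_eq_of_le (H : Fin m → QubitOp N) {t : ℕ → ℝ} {n n' : ℕ} (hn : n ≤ n')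
    (h : ∀ k, n ≤ k → k < n' → t k = 0) : cyclicEvolution H t n' = cyclicEvolution H t n := by
  induction n', hn using Nat.le_induction with
  | base => rfl
  | succ n' hn ih =>
    rw [cyclicEvolution, h n' hn n'.lt_succ_self, timeEvolution_zero, one_mul,
      ih fun k hk hk' => h k hk (hk'.trans n'.lt_succ_self)]

/-- Every product of evolutions is a cyclic evolution, in which the Hamiltonians that are not wanted
get duration zero. -/
theorem exists_cyclicEvolution_of_mem_closure (H : Fin m → QubitOp N) {U : QubitOp N}
    (hU : U ∈ Submonoid.closure {V | ∃ j, ∃ s : ℝ, 0 ≤ s ∧ V = timeEvolution (H j) s}) :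
    ∃ (n : ℕ) (t : ℕ → ℝ), (∀ k, 0 ≤ t k) ∧ U = cyclicEvolution H t n := by
  induction hU using Submonoid.closure_induction_left with
  | one => exact ⟨0, 0, fun _ => le_rfl, rfl⟩
  | mul_left V hV U _ ih =>
    obtain ⟨j, s, hs, rfl⟩ := hV
    obtain ⟨n, t, ht, rfl⟩ := ih
    -- Step `n * m + j` is the next one used; it runs with `H j`.
    have hle : n ≤ n * m + j :=
      (Nat.le_mul_of_pos_right n (Nat.pos_of_ne_zero (NeZero.ne m))).trans (Nat.le_add_right _ _)
    let t' : ℕ → ℝ := fun k => if k < n then t k else if k = n * m + j then s else 0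
    refine ⟨n * m + j + 1, t', fun k => ?_, ?_⟩
    · dsimp only [t']
      split_ifs
      exacts [ht k, hs, le_rfl]
    · have hj : Fin.ofNat m (n * m + j) = j := by
        ext
        simp [Fin.ofNat, Nat.mod_eq_of_lt j.2]
      have h₁ : t' (n * m + j) = s := by simp [t', hle.not_gt]
      rw [cyclicEvolution, hj, h₁, cyclicEvolution_eq_of_le H (t := t') hle fun k hk hk' => by
        simp [t', hk.not_gt, hk'.ne]]
      rw [cyclicEvolution_congr H (t := t) (t' := t') fun k hk => by simp [t', hk]]

theorem exists_eq_cyclicEvolution {H : Fin m → QubitOp N} (hH : IsCompleteFamily H) {U : QubitOp N}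
    (hU : U ∈ specialUnitaryGroup (Fin (2 ^ N)) ℂ) :
    ∃ (n : ℕ) (t : ℕ → ℝ), (∀ k, 0 ≤ t k) ∧ U = cyclicEvolution H t n := by
  refine exists_cyclicEvolution_of_mem_closure H (specialUnitaryGroup_le_of_lieSpan_eq hH ?_ ?_ hU)
  · rintro _ ⟨j, rfl⟩ t ht
    exact Submonoid.subset_closure ⟨j, t, ht, (timeEvolution_eq _ _).symm⟩
  · rw [Submonoid.closure_le]
    rintro _ ⟨j, s, -, rfl⟩
    have hj : (-Complex.I) • H j ∈ suAlgebra N := hH ▸ LieSubalgebra.subset_lieSpan ⟨j, rfl⟩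
    rw [timeEvolution_eq]
    exact exp_mem_specialUnitaryGroup_of_mem_suAlgebra ((suAlgebra N).smul_mem s hj)

end

/-! ### Generating the skew-Hermitian matrices -/

section
variable {n : Type*} [Fintype n] [DecidableEq n]

/-- The real antisymmetric matrix `E j k - E k j`. -/
noncomputable def skewUnit (j k : n) : Matrix n n ℂ := single j k 1 - single k j 1

theorem lie_skewUnit_skewUnit {j k l : n} (hjk : j ≠ k) (hkl : k ≠ l) (hjl : j ≠ l) :
    ⁅skewUnit j k, skewUnit k l⁆ = skewUnit j l := by
  simp [Ring.lie_def, skewUnit, sub_mul, mul_sub, hjk, hkl, hjl, hjk.symm, hkl.symm, hjl.symm]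

theorem lie_I_smul_single_skewUnit {j k : n} (hjk : j ≠ k) :
    ⁅Complex.I • single j j (1 : ℂ), skewUnit j k⁆ =
      Complex.I • (single j k 1 + single k j 1) := by
  simp [Ring.lie_def, skewUnit, sub_mul, mul_sub, hjk, hjk.symm]

theorem lie_skewUnit_I_smul_single {j k : n} (hjk : j ≠ k) :
    ⁅skewUnit j k, Complex.I • (single j k (1 : ℂ) + single k j 1)⁆ =
      (2 : ℝ) • (Complex.I • single j j (1 : ℂ) - Complex.I • single k k 1) := by
  simp only [Ring.lie_def, skewUnit, two_smul]
  simp [sub_mul, mul_sub, add_mul, mul_add, hjk, hjk.symm]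
  abel

/-- The matrices `E j k - E k j` and `i E j j` generate all skew-Hermitian matrices. -/
theorem Matrix.skewHermitian_mem_of_forall_single_mem {L : LieSubalgebra ℝ (Matrix n n ℂ)}
    (hd : ∀ j, Complex.I • single j j (1 : ℂ) ∈ L) (hs : ∀ j k, skewUnit j k ∈ L)
    {X : Matrix n n ℂ} (hX : Xᴴ = -X) : X ∈ L := by
  have hJ : ∀ j k, Complex.I • (single j k (1 : ℂ) + single k j 1) ∈ L := by
    intro j k
    by_cases hjk : j = k
    · subst hjk
      rw [smul_add]
      exact L.add_mem (hd j) (hd j)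
    · rw [← lie_I_smul_single_skewUnit hjk]
      exact L.lie_mem (hd j) (hs j k)
  have hsum : X = (2⁻¹ : ℝ) • ∑ j, ∑ k, ((X j k).re • skewUnit j k +
      (X j k).im • (Complex.I • (single j k (1 : ℂ) + single k j 1))) := by
    have hterm : ∀ j k, (X j k).re • skewUnit j k +
        (X j k).im • (Complex.I • (single j k (1 : ℂ) + single k j 1)) =
        single j k (X j k) - (single j k (X j k))ᴴ := by
      intro j k
      rw [conjTranspose_single]
      have h₁ : X j k = (X j k).re + (X j k).im * Complex.I := (Complex.re_add_im _).symm
      have h₂ : star (X j k) = (X j k).re - (X j k).im * Complex.I := by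
        apply Complex.ext <;> simp
      have h₃ : ∀ (a b : n) (z : ℂ), single a b z = z • single a b (1 : ℂ) := by simp
      rw [h₃ j k (X j k), h₃ k j (star (X j k)), h₂]
      conv_rhs => enter [1, 1]; rw [h₁]
      simp only [skewUnit, ← Complex.coe_smul]
      module
    simp_rw [hterm, Finset.sum_sub_distrib, ← conjTranspose_sum]
    rw [← matrix_eq_sum_single, hX, sub_neg_eq_add, ← two_smul ℝ, smul_smul]
    norm_num
  rw [hsum]
  exact L.smul_mem _ (sum_mem fun j _ => sum_mem fun k _ =>
    L.add_mem (L.smul_mem _ (hs j k)) (L.smul_mem _ (hJ j k)))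

end

/-! ### Hopping along a chain of levels -/

section
variable {d : ℕ}

/-- Nearest-neighbour hopping along a chain of `d` levels: the adjacency matrix of a path. -/
def chainHopping (d : ℕ) : Matrix (Fin d) (Fin d) ℂ :=
  of fun i j => if (i : ℕ) + 1 = j ∨ (j : ℕ) + 1 = i then 1 else 0

theorem chainHopping_isHermitian : (chainHopping d).IsHermitian := by
  ext i j
  simp only [chainHopping, conjTranspose_apply, of_apply]
  split_ifs <;> first | omega | simp

theorem trace_chainHopping : (chainHopping d).trace = 0 := by
  simp [trace, chainHopping]

theorem lie_single_chainHopping_apply (j a b : Fin d) :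
    ⁅Complex.I • single j j (1 : ℂ), Complex.I • chainHopping d⁆ a b =
      ((if b = j then 1 else 0) - (if a = j then 1 else 0)) * chainHopping d a b := by
  rw [← diagonal_single, Ring.lie_def]
  simp only [smul_mul_smul_comm, Complex.I_mul_I, Matrix.sub_apply, Matrix.smul_apply,
    diagonal_mul, mul_diagonal, Pi.single_apply, smul_eq_mul]
  ring

theorem lie_single_zero_chainHopping (h : 1 < d) :
    ⁅Complex.I • single (⟨0, by omega⟩ : Fin d) (⟨0, by omega⟩ : Fin d) (1 : ℂ),
      Complex.I • chainHopping d⁆ =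
      -skewUnit (⟨0, by omega⟩ : Fin d) ⟨1, h⟩ := by
  ext a b
  rw [lie_single_chainHopping_apply]
  simp only [chainHopping, skewUnit, of_apply, Matrix.neg_apply, Matrix.sub_apply, single_apply,
    Fin.ext_iff]
  split_ifs <;> first | omega | simp

theorem lie_single_succ_chainHopping {j : ℕ} (h : j + 2 < d) :
    ⁅Complex.I • single (⟨j + 1, by omega⟩ : Fin d) (⟨j + 1, by omega⟩ : Fin d) (1 : ℂ),
      Complex.I • chainHopping d⁆ =
      skewUnit (⟨j, by omega⟩ : Fin d) ⟨j + 1, by omega⟩ -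
        skewUnit (⟨j + 1, by omega⟩ : Fin d) ⟨j + 2, h⟩ := by
  ext a b
  rw [lie_single_chainHopping_apply]
  simp only [chainHopping, skewUnit, of_apply, Matrix.sub_apply, single_apply,
    Fin.ext_iff]
  split_ifs <;> first | omega | simp

/-- The hopping along a chain and the detuning of its first level generate all skew-Hermitian
matrices. -/
theorem skewHermitian_mem_of_chainHopping_mem {L : LieSubalgebra ℝ (Matrix (Fin d) (Fin d) ℂ)}
    (hhop : Complex.I • chainHopping d ∈ L)
    (h₀ : ∀ h : 0 < d, Complex.I • single ⟨0, h⟩ ⟨0, h⟩ (1 : ℂ) ∈ L)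
    {X : Matrix (Fin d) (Fin d) ℂ} (hX : Xᴴ = -X) : X ∈ L := by
  -- With `R = E j (j+1) - E (j+1) j`, the bracket `⁅R, ⁅i E j j, R⁆⁆` is
  -- `2 (i E j j - i E (j+1) (j+1))`.
  have hnext : ∀ j (h : j + 1 < d), Complex.I • single ⟨j, by omega⟩ ⟨j, by omega⟩ (1 : ℂ) ∈ L →
      skewUnit (⟨j, by omega⟩ : Fin d) ⟨j + 1, h⟩ ∈ L →
      Complex.I • single ⟨j + 1, h⟩ ⟨j + 1, h⟩ (1 : ℂ) ∈ L := by
    intro j h hj hs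
    have hne : (⟨j, by omega⟩ : Fin d) ≠ ⟨j + 1, h⟩ := by simp
    have h₁ := L.lie_mem hs (L.lie_mem hj hs)
    rw [lie_I_smul_single_skewUnit hne, lie_skewUnit_I_smul_single hne] at h₁
    have h₂ := L.sub_mem hj (L.smul_mem (2⁻¹ : ℝ) h₁)
    rw [smul_smul, inv_mul_cancel₀ two_ne_zero, one_smul, sub_sub_cancel] at h₂
    exact h₂
  -- Bracketing the detuning of level `j` with the hopping leaves the two links at level `j`, of
  -- which the one towards level `j - 1` is already known.
  have hchain : ∀ j (h : j + 1 < d), Complex.I • single ⟨j, by omega⟩ ⟨j, by omega⟩ (1 : ℂ) ∈ L ∧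
      skewUnit (⟨j, by omega⟩ : Fin d) ⟨j + 1, h⟩ ∈ L := by
    intro j
    induction j with
    | zero =>
      intro h
      refine ⟨h₀ _, ?_⟩
      have := L.neg_mem (L.lie_mem (h₀ (by omega)) hhop)
      rwa [lie_single_zero_chainHopping h, neg_neg] at this
    | succ j ih =>
      intro h
      obtain ⟨h₁, h₂⟩ := ih (by omega)
      have h₃ := hnext j _ h₁ h₂
      refine ⟨h₃, ?_⟩
      have := L.sub_mem h₂ (L.lie_mem h₃ hhop)
      rwa [lie_single_succ_chainHopping h, sub_sub_cancel] at this
  have hdiag : ∀ j : Fin d, Complex.I • single j j (1 : ℂ) ∈ L := by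
    rintro ⟨j, hj⟩
    cases j with
    | zero => exact h₀ hj
    | succ j => exact hnext j hj (hchain j hj).1 (hchain j hj).2
  -- Neighbouring links compose to links of every length.
  have hlt : ∀ (r j : ℕ) (h : j + r + 1 < d),
      skewUnit (⟨j, by omega⟩ : Fin d) ⟨j + r + 1, h⟩ ∈ L := by
    intro r
    induction r with
    | zero => exact fun j h => (hchain j h).2
    | succ r ih =>
      intro j h
      have := L.lie_mem (ih j (by omega)) (hchain (j + r + 1) h).2
      rwa [lie_skewUnit_skewUnit (by simp; omega) (by simp) (by simp; omega)] at this
  have hlt' : ∀ j k : Fin d, j < k → skewUnit j k ∈ L := by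
    intro j k hjk
    obtain ⟨r, hr⟩ := Nat.exists_eq_add_of_lt hjk
    have := hlt r j (hr ▸ k.2)
    convert! this
  refine skewHermitian_mem_of_forall_single_mem hdiag (fun j k => ?_) hX
  rcases lt_trichotomy j k with h | rfl | h
  · exact hlt' j k h
  · simp [skewUnit]
  · have := L.neg_mem (hlt' k j h)
    rwa [skewUnit, neg_sub] at this

end

/-! ### Traceless parts -/

section
variable {n : Type*} [Fintype n] [DecidableEq n]

/-- The traceless part `X - (tr X / d) • 1` of a `d × d` matrix. -/
noncomputable def tracelessPart : Matrix n n ℂ →ₗ[ℂ] Matrix n n ℂ :=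
  LinearMap.id - (Fintype.card n : ℂ)⁻¹ • (traceLinearMap n ℂ ℂ).smulRight 1

theorem tracelessPart_apply (X : Matrix n n ℂ) :
    tracelessPart X = X - ((Fintype.card n : ℂ)⁻¹ * X.trace) • (1 : Matrix n n ℂ) := by
  simp [tracelessPart, smul_smul]

theorem tracelessPart_of_trace_eq_zero {X : Matrix n n ℂ} (hX : X.trace = 0) :
    tracelessPart X = X := by
  simp [tracelessPart_apply, hX]

theorem trace_tracelessPart [Nonempty n] (X : Matrix n n ℂ) : (tracelessPart X).trace = 0 := by
  have : (Fintype.card n : ℂ) ≠ 0 := by exact_mod_cast Fintype.card_ne_zero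
  rw [tracelessPart_apply, trace_sub, trace_smul, trace_one, smul_eq_mul]
  field_simp
  ring

theorem Matrix.IsHermitian.tracelessPart {X : Matrix n n ℂ} (hX : X.IsHermitian) :
    (tracelessPart X).IsHermitian := by
  rw [Matrix.IsHermitian, tracelessPart_apply, conjTranspose_sub, conjTranspose_smul, hX.eq,
    conjTranspose_one, star_mul', ← trace_conjTranspose, hX.eq]
  simp

theorem lie_tracelessPart (X Y : Matrix n n ℂ) :
    ⁅tracelessPart X, tracelessPart Y⁆ = tracelessPart ⁅X, Y⁆ := by
  have h : (⁅X, Y⁆ : Matrix n n ℂ).trace = 0 := by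
    rw [Ring.lie_def, trace_sub, trace_mul_comm, sub_self]
  rw [tracelessPart_of_trace_eq_zero h, tracelessPart_apply, tracelessPart_apply]
  simp only [Ring.lie_def, sub_mul, mul_sub, smul_mul_assoc, mul_smul_comm, one_mul, mul_one]
  module

/-- The matrices whose traceless part lies in a given Lie algebra of matrices. -/
noncomputable def LieSubalgebra.comapTracelessPart (L : LieSubalgebra ℝ (Matrix n n ℂ)) :
    LieSubalgebra ℝ (Matrix n n ℂ) where
  toSubmodule := L.toSubmodule.comap (tracelessPart.restrictScalars ℝ)
  lie_mem' {X Y} hX hY := by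
    change _root_.tracelessPart _ ∈ L
    rw [← lie_tracelessPart]
    exact L.lie_mem hX hY

end

theorem mem_suAlgebra_of_isHermitian {N : ℕ} {A : QubitOp N} (hA : A.IsHermitian)
    (htr : A.trace = 0) : (-Complex.I) • A ∈ suAlgebra N :=
  ⟨by simp [hA.eq], by simp [htr]⟩

/-- Brackets do not see scalar matrices, so the traceless parts of generators of all skew-Hermitian
matrices generate `su(2 ^ N)`. -/
theorem suAlgebra_le_of_chainHopping_mem {N : ℕ} {L : LieSubalgebra ℝ (QubitOp N)}
    (hhop : Complex.I • chainHopping (2 ^ N) ∈ L)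
    (h₀ : Complex.I • tracelessPart (single 0 0 (1 : ℂ)) ∈ L) : suAlgebra N ≤ L := by
  intro X hX
  have hX' : X ∈ L.comapTracelessPart := by
    refine skewHermitian_mem_of_chainHopping_mem ?_ (fun h => ?_) hX.1
    · change tracelessPart _ ∈ L
      rwa [map_smul, tracelessPart_of_trace_eq_zero trace_chainHopping]
    · change tracelessPart _ ∈ L
      rwa [map_smul]
  have : tracelessPart X ∈ L := hX'
  rwa [tracelessPart_of_trace_eq_zero hX.2] at this

/-! ### A complete device -/

/-- A chain of `2 ^ N` levels with nearest-neighbour hopping, which is on for every configuration;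
switch `i` (`i = 0, …, N`, which is possible as `N < 2 ^ N`) detunes level `i`. The detunings are
made traceless by subtracting a scalar matrix. -/
noncomputable def detunedChain (N : ℕ) : SwitchedDevice N (N + 1) where
  hamiltonian c := chainHopping (2 ^ N) + ∑ i, if c i then
    tracelessPart (single (Fin.castLE Nat.lt_two_pow_self i) (Fin.castLE Nat.lt_two_pow_self i) 1)
    else 0
  isHermitian c := by
    refine chainHopping_isHermitian.add (isSelfAdjoint_sum _ fun i _ => ?_)
    split_ifs
    · exact IsHermitian.tracelessPart (by simp [Matrix.IsHermitian, conjTranspose_single])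
    · exact IsSelfAdjoint.zero _

/-- The `M + 1` configurations of `M` switches with at most one switch on: all off for `0`, and only
switch `i` on for `i + 1`. -/
def atMostOneOn (M : ℕ) : Fin (M + 1) → Fin M → Bool :=
  Fin.cons (fun _ => false) fun i k => decide (k = i)

theorem detunedChain_hamiltonian_zero (N : ℕ) :
    (detunedChain N).hamiltonian (atMostOneOn (N + 1) 0) = chainHopping (2 ^ N) := by
  simp [detunedChain, atMostOneOn]

theorem detunedChain_hamiltonian_succ (N : ℕ) (i : Fin (N + 1)) :
    (detunedChain N).hamiltonian (atMostOneOn (N + 1) i.succ) = chainHopping (2 ^ N) +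
      tracelessPart (single (Fin.castLE Nat.lt_two_pow_self i)
        (Fin.castLE Nat.lt_two_pow_self i) 1) := by
  simp [detunedChain, atMostOneOn]

theorem tracelessPart_single_ne_zero {n : Type*} [Fintype n] [DecidableEq n] [Nontrivial n]
    (i : n) : tracelessPart (single i i (1 : ℂ)) ≠ 0 := by
  obtain ⟨k, hk⟩ := exists_ne i
  intro h
  have := congrFun (congrFun h k) k
  simp [tracelessPart_apply, hk.symm] at this

theorem tracelessPart_single_injective {n : Type*} [Fintype n] [DecidableEq n] :
    Function.Injective fun i : n => tracelessPart (single i i (1 : ℂ)) := by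
  intro i k h
  by_contra hik
  have := congrFun (congrFun h i) i
  simp [tracelessPart_apply, Ne.symm hik] at this

theorem detunedChain_injective {N : ℕ} (hN : 1 ≤ N) :
    Function.Injective fun j => (detunedChain N).hamiltonian (atMostOneOn (N + 1) j) := by
  have : Nontrivial (Fin (2 ^ N)) := Fin.nontrivial_iff_two_le.2 (Nat.le_self_pow (by omega) 2)
  intro j k h
  dsimp only at h
  induction j using Fin.cases with
  | zero =>
    induction k using Fin.cases with
    | zero => rfl
    | succ k =>
      rw [detunedChain_hamiltonian_zero, detunedChain_hamiltonian_succ, left_eq_add] at h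
      exact absurd h (tracelessPart_single_ne_zero _)
  | succ j =>
    induction k using Fin.cases with
    | zero =>
      rw [detunedChain_hamiltonian_zero, detunedChain_hamiltonian_succ, add_eq_left] at h
      exact absurd h (tracelessPart_single_ne_zero _)
    | succ k =>
      rw [detunedChain_hamiltonian_succ, detunedChain_hamiltonian_succ, add_right_inj] at h
      rw [Fin.castLE_injective _ (tracelessPart_single_injective h)]

theorem detunedChain_isCompleteFamily (N : ℕ) :
    IsCompleteFamily fun j => (detunedChain N).hamiltonian (atMostOneOn (N + 1) j) := by
  have hhop : (-Complex.I) • chainHopping (2 ^ N) ∈ suAlgebra N :=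
    mem_suAlgebra_of_isHermitian chainHopping_isHermitian trace_chainHopping
  refine le_antisymm (LieSubalgebra.lieSpan_le.2 ?_) (suAlgebra_le_of_chainHopping_mem ?_ ?_)
  · rintro _ ⟨j, rfl⟩
    refine mem_suAlgebra_of_isHermitian ((detunedChain N).isHermitian _) ?_
    dsimp only
    induction j using Fin.cases with
    | zero => rw [detunedChain_hamiltonian_zero, trace_chainHopping]
    | succ i =>
      rw [detunedChain_hamiltonian_succ, trace_add, trace_chainHopping, trace_tracelessPart,
        add_zero]
  all_goals
    set L := LieSubalgebra.lieSpan ℝ (QubitOp N) (Set.range fun j =>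
      (-Complex.I) • (detunedChain N).hamiltonian (atMostOneOn (N + 1) j))
    have h₁ : (-Complex.I) • chainHopping (2 ^ N) ∈ L := by
      rw [← detunedChain_hamiltonian_zero]
      exact LieSubalgebra.subset_lieSpan ⟨0, rfl⟩
  · simpa using L.neg_mem h₁
  · have h₂ : (-Complex.I) • (detunedChain N).hamiltonian (atMostOneOn (N + 1) (Fin.succ 0)) ∈ L :=
      LieSubalgebra.subset_lieSpan ⟨Fin.succ 0, rfl⟩
    rw [detunedChain_hamiltonian_succ] at h₂
    have h0 : Fin.castLE Nat.lt_two_pow_self (0 : Fin (N + 1)) = (0 : Fin (2 ^ N)) := rfl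
    rw [h0] at h₂
    simpa using L.sub_mem h₁ h₂

theorem proposition3 (N : ℕ) :
    (∀ (M m : ℕ) [NeZero m] (D : SwitchedDevice N M) (c : Fin m → (Fin M → Bool)),
      IsCompleteFamily (fun j => D.hamiltonian (c j)) →
      ∀ U ∈ Matrix.specialUnitaryGroup (Fin (2 ^ N)) ℂ,
        ∃ (n : ℕ) (t : ℕ → ℝ), (∀ k, 0 ≤ t k) ∧
          U = cyclicEvolution (fun j => D.hamiltonian (c j)) t n) ∧
    (1 ≤ N →
      ∃ (D : SwitchedDevice N (N + 1)) (c : Fin (N + 2) → (Fin (N + 1) → Bool)),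
        Function.Injective (fun j => D.hamiltonian (c j)) ∧
        IsCompleteFamily (fun j => D.hamiltonian (c j))) :=
  ⟨fun _ _ _ _ _ hc _ hU => exists_eq_cyclicEvolution hc hU, fun hN =>
    ⟨detunedChain N, atMostOneOn (N + 1), detunedChain_injective hN,
      detunedChain_isCompleteFamily N⟩⟩
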